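/- Let $w_1,\dots,w_n\in\mathbb{R}_{\ge 0}$ be $n$ weights ($n \ge 0$), and let $\mathcal{M}$ be a matroid with finite ground set $N$ of size $k\le n$ and rank function $r$. Choose a uniformly random $k$-element subset of (the index set of) the $n$ weights and assign the chosen weights to the elements of $N$ by a uniformly random bijection. Let $w(\mathrm{OPT}(\mathcal{M}))$ denote the maximum total weight of an independent set of $\mathcal{M}$ under this assignment. For $\lambda\ge 0$, let $D(N,\lambda)$ be the unique inclusion-wise maximal set among the maximizers of $|U|-\lambda\, r(U)$ over all $U\subseteq N$. The rank-density curve $\rho_{\mathcal{M}}\colon\mathbb{R}_{>0}\to\mathbb{R}_{\ge 0}$ is $$\rho_{\mathcal{M}}(t)=\max\{\lambda\ge 0 : r(D(N,\lambda))\ge t\}\ \text{ for } 0<t\le r(N),\qquad \rho_{\mathcal{M}}(t)=0\ \text{ for } t>r(N).$$ For $a\in[0,n]$ let $\eta(a)$ be the expected maximum of $w_i$ over $i\in R$, where $R$ is a uniformly random $\lfloor a\rfloor$-element subset of $\{1,\dots,n\}$ (with $\eta(a)=0$ if $a<1$), and let $$F(\rho_{\mathcal{M}})=\int_0^\infty \eta(\rho_{\mathcal{M}}(t))\,dt.$$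 Then $$\mathbb{E}\left[w(\mathrm{OPT}(\mathcal{M}))\right]\le \frac{3e}{e-1}\cdot F(\rho_{\mathcal{M}}).$$ -/

import Mathlib

namespace RandomAssignment

section

open Set
open scoped BigOperators

variable {α : Type*}

/-- The rank function `r` of a finite matroid, with natural number values. -/
noncomputable def rank (M : Matroid α) (U : Set α) : ℕ := (M.eRk U).toNat

/-- The sets `U ⊆ S` that maximize `|U| - lam * r(U)` among all subsets of `S`. -/
def maximizers (M : Matroid α) (S : Set α) (lam : ℝ) : Set (Set α) :=
  {U | U ⊆ S ∧ ∀ V ⊆ S, (V.ncard : ℝ) - lam * rank M V ≤ (U.ncard : ℝ) - lam * rank M U}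

/-- The unique maximal maximizer `D_M(S, lam)` of `|U| - lam * r(U)` over `U ⊆ S`, obtained as
the union of all maximizers. For `S ⊆ M.E` and `0 ≤ lam` it is itself a maximizer and contains
all others, see `isGreatest_denseSet`. -/
def denseSet (M : Matroid α) (S : Set α) (lam : ℝ) : Set α :=
  ⋃₀ maximizers M S lam

/-- The rank-density curve: for `0 < t ≤ r(E)` its value is the largest `lam ≥ 0` with
`r(D_M(E, lam)) ≥ t` (a maximum, see `isGreatest_rankDensity`), and it is `0` for `t > r(E)`.
The curve is only meant for `t > 0`; other arguments get the value `0`. -/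
noncomputable def rankDensity (M : Matroid α) (t : ℝ) : ℝ :=
  open Classical in
  if 0 < t ∧ t ≤ rank M M.E then
    sSup {lam : ℝ | 0 ≤ lam ∧ t ≤ rank M (denseSet M M.E lam)}
  else 0

/-- The largest weight with index in `R`, and `0` if `R` is empty. -/
noncomputable def maxWeight {n : ℕ} (w : Fin n → ℝ) (R : Finset (Fin n)) : ℝ :=
  if h : R.Nonempty then R.sup' h w else 0

/-- `η(a)` for `a ∈ [0, n]`: the expected maximum of `⌊a⌋` of the `n` weights, drawn uniformly
at random without repetitions. -/
noncomputable def eta {n : ℕ} (w : Fin n → ℝ) (a : ℝ) : ℝ :=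
  𝔼 R ∈ Finset.powersetCard ⌊a⌋₊ (Finset.univ : Finset (Fin n)), maxWeight w R

/-- `F(ρ) = ∫₀^∞ η(ρ(t)) dt`. -/
noncomputable def curveValue {n : ℕ} (w : Fin n → ℝ) (ρ : ℝ → ℝ) : ℝ :=
  ∫ t in Ioi (0 : ℝ), eta w (ρ t)

/-- The weight `v(OPT(M))` of a maximum weight independent set of `M`, where the elements of `M`
have the weights `v` (a maximum if `M` is finite, see `isGreatest_optWeight`). -/
noncomputable def optWeight (M : Matroid α) (v : M.E → ℝ) : ℝ :=
  sSup {x : ℝ | ∃ I : Finset M.E,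
    M.Indep (Subtype.val '' (I : Set M.E)) ∧ x = ∑ e ∈ I, v e}

/-- The expectation of `w(OPT(M))` if first a uniformly random set `S` of `|E|` of the `n` weights
is chosen and then these weights are assigned to the elements of `M` by a uniformly random
bijection `σ : E ≃ S`. -/
noncomputable def expectedOpt {n : ℕ} (M : Matroid α) [M.Finite] (w : Fin n → ℝ) : ℝ :=
  letI : Fintype M.E := M.ground_finite.fintype
  open Classical in
  𝔼 S ∈ Finset.powersetCard M.E.ncard (Finset.univ : Finset (Fin n)),
    𝔼 σ : (M.E ≃ S), optWeight M (fun e => w (σ e))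

/-! The extrema in the definitions are attained. -/

theorem coe_rank (M : Matroid α) [M.Finite] (U : Set α) : (rank M U : ℕ∞) = M.eRk U := by
  refine ENat.natCast_toNat ?_
  rw [← M.eRk_inter_ground U]
  refine ((M.eRk_le_encard _).trans_lt ?_).ne
  exact (M.ground_finite.subset inter_subset_right).encard_lt_top

theorem rank_mono (M : Matroid α) [M.Finite] {U V : Set α} (h : U ⊆ V) :
    rank M U ≤ rank M V := by
  have := M.eRk_mono h
  rw [← coe_rank, ← coe_rank] at this
  exact_mod_cast this

theorem rank_submod (M : Matroid α) [M.Finite] (U V : Set α) :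
    rank M (U ∩ V) + rank M (U ∪ V) ≤ rank M U + rank M V := by
  have := M.eRk_submod U V
  simp only [← coe_rank] at this
  exact_mod_cast this

theorem union_mem_maximizers (M : Matroid α) [M.Finite] {S : Set α} (hS : S ⊆ M.E) {lam : ℝ}
    (hl : 0 ≤ lam) {U V : Set α} (hU : U ∈ maximizers M S lam) (hV : V ∈ maximizers M S lam) :
    U ∪ V ∈ maximizers M S lam := by
  refine ⟨union_subset hU.1 hV.1, fun W hW => ?_⟩
  have h1 := hU.2 (U ∩ V) (inter_subset_left.trans hU.1)
  have h2 := hV.2 W hW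
  have hc : ((U ∪ V).ncard : ℝ) + (U ∩ V).ncard = U.ncard + V.ncard := by
    exact_mod_cast ncard_union_add_ncard_inter U V
      (M.ground_finite.subset (hU.1.trans hS)) (M.ground_finite.subset (hV.1.trans hS))
  have hr : (rank M (U ∩ V) : ℝ) + rank M (U ∪ V) ≤ rank M U + rank M V := by
    exact_mod_cast rank_submod M U V
  nlinarith [mul_le_mul_of_nonneg_left hr hl]

theorem isGreatest_denseSet (M : Matroid α) [M.Finite] {S : Set α} (hS : S ⊆ M.E) {lam : ℝ}
    (hl : 0 ≤ lam) : IsGreatest (maximizers M S lam) (denseSet M S lam) := by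
  refine ⟨?_, fun U hU => subset_sUnion_of_mem hU⟩
  have hfin : {U | U ⊆ S}.Finite := (M.ground_finite.subset hS).finite_subsets
  have hne : (maximizers M S lam).Nonempty := by
    obtain ⟨U, hU, h⟩ := exists_max_image {U | U ⊆ S}
      (fun U => (U.ncard : ℝ) - lam * rank M U) hfin ⟨∅, empty_subset S⟩
    exact ⟨U, hU, h⟩
  obtain ⟨U, hU⟩ := (hfin.subset (fun U (hU : U ∈ maximizers M S lam) => hU.1)).exists_maximal hne
  have : denseSet M S lam = U := by
    refine subset_antisymm (sUnion_subset fun V hV => ?_) (subset_sUnion_of_mem hU.1)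
    exact subset_union_right.trans
      (hU.2 (union_mem_maximizers M hS hl hU.1 hV) subset_union_left)
  rw [this]
  exact hU.1

theorem isGreatest_rankDensity (M : Matroid α) [M.Finite] {t : ℝ} (ht : 0 < t)
    (ht' : t ≤ rank M M.E) :
    IsGreatest {lam : ℝ | 0 ≤ lam ∧ t ≤ rank M (denseSet M M.E lam)} (rankDensity M t) := by
  have hD := fun {lam : ℝ} (hl : 0 ≤ lam) => isGreatest_denseSet M subset_rfl hl
  rw [rankDensity, if_pos ⟨ht, ht'⟩]
  set A := {lam : ℝ | 0 ≤ lam ∧ t ≤ rank M (denseSet M M.E lam)} with hA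
  have hne : A.Nonempty := by
    refine ⟨0, le_rfl, ht'.trans ?_⟩
    have : M.E ∈ maximizers M M.E 0 := ⟨subset_rfl, fun V hV => by
      simpa using ncard_le_ncard hV M.ground_finite⟩
    exact_mod_cast rank_mono M ((hD le_rfl).2 this)
  have hbdd : BddAbove A := by
    refine ⟨M.E.ncard, fun lam hl => ?_⟩
    have h1 := (hD hl.1).1.2 ∅ (empty_subset _)
    have h2 : (rank M ∅ : ℝ) = 0 := by simp [rank]
    have h3 : (1 : ℝ) ≤ rank M (denseSet M M.E lam) := by
      have : (0 : ℝ) < rank M (denseSet M M.E lam) := ht.trans_le hl.2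
      exact_mod_cast this
    have h4 : ((denseSet M M.E lam).ncard : ℝ) ≤ M.E.ncard := by
      exact_mod_cast ncard_le_ncard (hD hl.1).1.1 M.ground_finite
    rw [h2, ncard_empty] at h1
    push_cast at h1
    nlinarith [hl.1]
  have hcl : IsClosed A := by
    have hU : A = ⋃ U ∈ {U | U ⊆ M.E ∧ t ≤ rank M U},
        {lam : ℝ | 0 ≤ lam ∧ U ∈ maximizers M M.E lam} := by
      ext lam
      simp only [hA, mem_ofPred_eq, mem_iUnion, exists_prop]
      constructor
      · rintro ⟨h0, h⟩
        exact ⟨_, ⟨(hD h0).1.1, h⟩, h0, (hD h0).1⟩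
      · rintro ⟨U, ⟨-, h⟩, h0, hU⟩
        exact ⟨h0, h.trans (by exact_mod_cast rank_mono M ((hD h0).2 hU))⟩
    rw [hU]
    refine (M.ground_finite.finite_subsets.subset fun U h => h.1).isClosed_biUnion fun U h => ?_
    have : {lam : ℝ | 0 ≤ lam ∧ U ∈ maximizers M M.E lam} = Ici 0 ∩ ⋂ V ∈ {V | V ⊆ M.E},
        {lam : ℝ | (V.ncard : ℝ) - lam * rank M V ≤ (U.ncard : ℝ) - lam * rank M U} := by
      ext lam
      simp [maximizers, h.1]
    rw [this]
    refine isClosed_Ici.inter (isClosed_biInter fun V _ => isClosed_le ?_ ?_) <;> fun_prop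
  exact ⟨hcl.csSup_mem hne hbdd, fun lam hl => le_csSup hbdd hl⟩

theorem isGreatest_optWeight (M : Matroid α) [M.Finite] (v : M.E → ℝ) :
    IsGreatest {x : ℝ | ∃ I : Finset M.E,
      M.Indep (Subtype.val '' (I : Set M.E)) ∧ x = ∑ e ∈ I, v e} (optWeight M v) := by
  have : Finite M.E := M.ground_finite
  have hfin : {x : ℝ | ∃ I : Finset M.E,
      M.Indep (Subtype.val '' (I : Set M.E)) ∧ x = ∑ e ∈ I, v e}.Finite := by
    refine (finite_range fun I : Finset M.E => ∑ e ∈ I, v e).subset ?_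
    rintro x ⟨I, -, rfl⟩
    exact ⟨I, rfl⟩
  exact ⟨Set.Nonempty.csSup_mem ⟨0, ∅, by simp⟩ hfin, fun x hx => le_csSup hfin.bddAbove hx⟩

end

end RandomAssignment

/-! Write each weight as a nonnegative combination of threshold indicators `v ≤ w i`, and treat one
threshold at a time. Let `p` be the fraction of weights above it. For any set `D`, an independent
set has at most `r(D)` elements in `D`, so the expected number of its elements above the threshold
is at most `r(D) + p |E \ D|`, even when the set depends on the assignment.

The choice `D = D(E, 1/p)` bounds this by `∑ₖ min(1, p ρ(k+1))` (`exists_rank_add_le_sum_min`). The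
terms with `k < r(D)` equal `1`; the others equal `p ρ(k+1)` and pay for `|E \ D|`
(`ncard_diff_denseSet_le`).

Conversely, `⌊a⌋` random indices hit the threshold set with probability at least `1 - (1 - p)^⌊a⌋ ≥
(1 - 1/e) min(1, p ⌊a⌋)`, and `a ≤ 2 ⌊a⌋` for `a ≥ 1`. Summing over thresholds gives
`layers_le_eta`. Since `F(ρ) = ∑ₖ η(ρ(k+1))`, the two bounds combine, in fact with the constant
`2e/(e-1)`. -/

namespace RandomAssignment

open Set
open scoped BigOperators

/-! ### The rank-density curve as a step function with the breakpoints of a convex function -/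

section Curve

variable {α : Type*} (M : Matroid α) [M.Finite]

theorem rank_le_ncard (U : Set α) (hU : U.Finite) : rank M U ≤ U.ncard := by
  have h := M.eRk_le_encard U
  rw [← coe_rank, ← hU.cast_ncard_eq] at h
  exact_mod_cast h

theorem rank_ground_le_add {V : Set α} (hV : V ⊆ M.E) :
    rank M M.E ≤ rank M V + (M.E \ V).ncard := by
  have h := rank_submod M V (M.E \ V)
  rw [union_sdiff_cancel hV] at h
  have := rank_le_ncard M (M.E \ V) (M.ground_finite.subset sdiff_subset)
  omega

theorem ncard_eq_add_diff {V : Set α} (hV : V ⊆ M.E) :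
    (M.E.ncard : ℝ) = V.ncard + (M.E \ V).ncard := by
  have := ncard_sdiff_add_ncard_of_subset hV M.ground_finite
  rw [← this]; push_cast; ring

/-- The maximum of `|U| - lam * r(U)` over all subsets `U` of the ground set. -/
noncomputable def maxExcess (lam : ℝ) : ℝ :=
  ((denseSet M M.E lam).ncard : ℝ) - lam * rank M (denseSet M M.E lam)

theorem le_maxExcess {lam : ℝ} (hl : 0 ≤ lam) {U : Set α} (hU : U ⊆ M.E) :
    (U.ncard : ℝ) - lam * rank M U ≤ maxExcess M lam :=
  (isGreatest_denseSet M subset_rfl hl).1.2 U hU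

/-- Subgradient inequality: `maxExcess` is a maximum of functions affine in `lam`, and the one
attaining it at `lam` has slope `-r(D(E, lam))`. -/
theorem maxExcess_le_add {lam mu : ℝ} (hl : 0 ≤ lam) (hm : 0 ≤ mu) :
    maxExcess M lam ≤ maxExcess M mu + (mu - lam) * rank M (denseSet M M.E lam) := by
  have := le_maxExcess M hm (isGreatest_denseSet M subset_rfl hl).1.1
  rw [maxExcess]
  linarith

theorem rankDensity_of_gt {α : Type*} (M : Matroid α) {t : ℝ} (ht : rank M M.E < t) : rankDensity M t = 0 :=
  if_neg fun h => ht.not_ge h.2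

theorem rankDensity_nonneg (t : ℝ) : 0 ≤ rankDensity M t := by
  by_cases h : 0 < t ∧ t ≤ rank M M.E
  · exact (isGreatest_rankDensity M h.1 h.2).1.1
  · rw [rankDensity, if_neg h]

theorem le_rankDensity {t lam : ℝ} (ht : 0 < t) (hl : 0 ≤ lam)
    (h : t ≤ rank M (denseSet M M.E lam)) : lam ≤ rankDensity M t := by
  have hE : (rank M (denseSet M M.E lam) : ℝ) ≤ rank M M.E := by
    exact_mod_cast rank_mono M (isGreatest_denseSet M subset_rfl hl).1.1
  exact (isGreatest_rankDensity M ht (h.trans hE)).2 ⟨hl, h⟩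

theorem rank_denseSet_le_of_rankDensity_lt {k : ℕ} {lam : ℝ}
    (hl : rankDensity M (k + 1 : ℕ) < lam) : rank M (denseSet M M.E lam) ≤ k := by
  by_contra! h
  refine hl.not_ge (le_rankDensity M (by positivity) ((rankDensity_nonneg M _).trans hl.le) ?_)
  exact_mod_cast h

theorem rankDensity_antitone {s t : ℝ} (hs : 0 < s) (h : s ≤ t) :
    rankDensity M t ≤ rankDensity M s := by
  by_cases ht : t ≤ rank M M.E
  · have := (isGreatest_rankDensity M (hs.trans_le h) ht).1
    exact le_rankDensity M hs this.1 (h.trans this.2)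
  · rw [rankDensity_of_gt M (not_le.1 ht)]
    exact rankDensity_nonneg M s

/-- Ranks are integers, so the curve is constant on each `(k, k+1]`. -/
theorem rankDensity_eq_ceil {α : Type*} (M : Matroid α) {t : ℝ} (ht : 0 < t) : rankDensity M t = rankDensity M ⌈t⌉₊ := by
  have h : ∀ m : ℕ, t ≤ m ↔ (⌈t⌉₊ : ℝ) ≤ m := fun m => by rw [Nat.cast_le, Nat.ceil_le]
  have h0 : 0 < (⌈t⌉₊ : ℝ) := ht.trans_le (Nat.le_ceil t)
  simp only [rankDensity, h, ht, h0]

/-- Adding an element raises the rank by at most one, so `E` itself maximizes `|U| - r(U)`. This is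
what keeps the floor in `η` positive. -/
theorem one_le_rankDensity {k : ℕ} (hk : k < rank M M.E) :
    1 ≤ rankDensity M (k + 1 : ℕ) := by
  refine le_rankDensity M (by positivity) zero_le_one ?_
  have hE : M.E ∈ maximizers M M.E 1 := by
    refine ⟨subset_rfl, fun V hV => ?_⟩
    have h1 : (rank M M.E : ℝ) ≤ rank M V + (M.E \ V).ncard := by
      exact_mod_cast rank_ground_le_add M hV
    have h2 := ncard_eq_add_diff M hV
    linarith
  have := rank_mono M ((isGreatest_denseSet M subset_rfl zero_le_one).2 hE)
  exact_mod_cast (Nat.succ_le_of_lt hk).trans this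

theorem rankDensity_le_ncard (t : ℝ) : rankDensity M t ≤ M.E.ncard := by
  by_cases h : 0 < t ∧ t ≤ rank M M.E
  · obtain ⟨h0, h1⟩ := (isGreatest_rankDensity M h.1 h.2).1
    obtain ⟨hsub, hmax⟩ := (isGreatest_denseSet M subset_rfl h0).1
    have h2 := hmax ∅ (empty_subset _)
    have h3 : (1 : ℝ) ≤ rank M (denseSet M M.E (rankDensity M t)) := by
      have : (0 : ℝ) < rank M (denseSet M M.E (rankDensity M t)) := h.1.trans_le h1
      exact_mod_cast this
    have h4 : ((denseSet M M.E (rankDensity M t)).ncard : ℝ) ≤ M.E.ncard := by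
      exact_mod_cast ncard_le_ncard hsub M.ground_finite
    have h5 : (rank M ∅ : ℝ) = 0 := by simp [rank]
    rw [ncard_empty, h5] at h2
    push_cast at h2
    nlinarith
  · rw [rankDensity, if_neg h]
    positivity

/-- To the right of `ρ(k+1)` the dense sets have rank at most `k`, so `maxExcess` falls there with
slope at least `-k`. At `ρ(k+1)` itself the rank may be larger, hence the approach from the right.
-/
theorem maxExcess_rankDensity_le {k : ℕ} {mu : ℝ} (hm : rankDensity M (k + 1 : ℕ) ≤ mu) :
    maxExcess M (rankDensity M (k + 1 : ℕ)) ≤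
      maxExcess M mu + (mu - rankDensity M (k + 1 : ℕ)) * k := by
  set lam := rankDensity M (k + 1 : ℕ) with hlam
  have hl : 0 ≤ lam := rankDensity_nonneg M _
  refine le_of_forall_pos_le_add fun δ hδ => ?_
  rcases hm.eq_or_lt with h | h
  · rw [← h]; linarith
  have hr : (0 : ℝ) < rank M M.E + 1 := by positivity
  -- The first step, of length `ε`, costs at most `ε r(E) ≤ δ`; the `+ 1` avoids division by zero.
  set ε := min (mu - lam) (δ / (rank M M.E + 1)) with hε
  have hε0 : 0 < ε := lt_min (by linarith) (by positivity)
  have hε1 : ε ≤ mu - lam := min_le_left _ _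
  have hε2 : ε * (rank M M.E + 1) ≤ δ := (le_div_iff₀ hr).1 (min_le_right _ _)
  have h1 := maxExcess_le_add M hl (add_nonneg hl hε0.le)
  have h2 := maxExcess_le_add M (add_nonneg hl hε0.le) (hl.trans hm)
  have h3 : (rank M (denseSet M M.E (lam + ε)) : ℝ) ≤ k := by
    exact_mod_cast rank_denseSet_le_of_rankDensity_lt M (by linarith)
  have h4 : (rank M (denseSet M M.E lam) : ℝ) ≤ rank M M.E := by
    exact_mod_cast rank_mono M (isGreatest_denseSet M subset_rfl hl).1.1
  have h5 := mul_le_mul_of_nonneg_left h3 (by linarith : 0 ≤ mu - (lam + ε))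
  have h6 := mul_le_mul_of_nonneg_left h4 hε0.le
  have h7 : 0 ≤ ε * (k : ℝ) := by positivity
  nlinarith

/-- Follow `maxExcess` from `mu` down to `0` through the breakpoints `ρ(d+1) ≥ ρ(d+2) ≥ …`, bounding
its growth on each piece; summation by parts turns the total into a sum of values of `ρ`. -/
theorem ncard_diff_denseSet_le {mu : ℝ} (hm : 0 ≤ mu) :
    ((M.E \ denseSet M M.E mu).ncard : ℝ) ≤
      ∑ k ∈ Finset.Ico (rank M (denseSet M M.E mu)) (rank M M.E), rankDensity M (k + 1 : ℕ) := by
  set D := denseSet M M.E mu with hD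
  set d := rank M D with hd
  have hDE : D ⊆ M.E := (isGreatest_denseSet M subset_rfl hm).1.1
  have hdr : d ≤ rank M M.E := rank_mono M hDE
  have key : ∀ k, d ≤ k → maxExcess M (rankDensity M (k + 1 : ℕ)) ≤
      D.ncard + ∑ j ∈ Finset.Ico d k, rankDensity M (j + 1 : ℕ)
        - rankDensity M (k + 1 : ℕ) * k := by
    intro k hk
    induction k, hk using Nat.le_induction with
    | base =>
      have hle : rankDensity M (d + 1 : ℕ) ≤ mu := by
        -- Otherwise the rank of the dense set would increase from `mu` to the larger `ρ(d+1)`;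
        -- adding the two subgradient inequalities excludes this.
        by_contra! h
        have h1 : 0 < rankDensity M (d + 1 : ℕ) := hm.trans_lt h
        have h2 : ((d + 1 : ℕ) : ℝ) ≤ rank M M.E := by
          by_contra! h2
          exact h1.ne' (rankDensity_of_gt M h2)
        have h3 := (isGreatest_rankDensity M (by positivity) h2).1.2
        set lam := rankDensity M (d + 1 : ℕ)
        have h4 := maxExcess_le_add M h1.le hm
        have h5 := maxExcess_le_add M hm h1.le
        have h6 : (d : ℝ) + 1 ≤ rank M (denseSet M M.E lam) := by exact_mod_cast h3
        rw [← hD, ← hd] at h5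
        nlinarith
      have := maxExcess_rankDensity_le M hle
      rw [maxExcess.eq_def M mu, ← hD, ← hd] at this
      simp only [Finset.Ico_self, Finset.sum_empty]
      linarith
    | succ k hk ih =>
      rw [Finset.sum_Ico_succ_top hk]
      have := maxExcess_rankDensity_le M (k := k + 1) (mu := rankDensity M (k + 1 : ℕ))
        (rankDensity_antitone M (by positivity) (by norm_num))
      push_cast at this ih ⊢
      linarith
  have h := key _ hdr
  -- Past the full rank the curve is `0`, so the walk ends at `maxExcess M 0 ≥ |E|`.
  rw [rankDensity_of_gt M (t := (rank M M.E + 1 : ℕ)) (by norm_num)] at h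
  have h0 := le_maxExcess M le_rfl (subset_refl M.E)
  have := ncard_eq_add_diff M hDE
  linarith

/-- For `D = D(E, 1/p)` the index `r(D)` separates the `k` with `ρ(k+1) ≥ 1/p` from those with
`ρ(k+1) ≤ 1/p`, so it decides which entry attains each minimum. -/
theorem exists_rank_add_le_sum_min {p : ℝ} (hp : 0 < p) :
    ∃ D ⊆ M.E, rank M D + p * (M.E \ D).ncard ≤
      ∑ k ∈ Finset.range (rank M M.E), min 1 (p * rankDensity M (k + 1 : ℕ)) := by
  have hm : 0 ≤ p⁻¹ := by positivity
  set D := denseSet M M.E p⁻¹ with hD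
  have hDE : D ⊆ M.E := (isGreatest_denseSet M subset_rfl hm).1.1
  refine ⟨D, hDE, ?_⟩
  rw [← Finset.sum_range_add_sum_Ico _ (rank_mono M hDE)]
  refine add_le_add ?_ ?_
  · refine le_of_eq ?_
    rw [Finset.sum_congr rfl (g := fun _ => (1 : ℝ))]
    · simp
    intro k hk
    refine min_eq_left ?_
    have : p⁻¹ ≤ rankDensity M (k + 1 : ℕ) := by
      refine le_rankDensity M (by positivity) hm ?_
      exact_mod_cast Finset.mem_range.1 hk
    calc 1 = p * p⁻¹ := (mul_inv_cancel₀ hp.ne').symm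
      _ ≤ _ := by gcongr
  · refine (mul_le_mul_of_nonneg_left (ncard_diff_denseSet_le M hm) hp.le).trans ?_
    rw [Finset.mul_sum]
    refine Finset.sum_le_sum fun k hk => le_min ?_ le_rfl
    have : rankDensity M (k + 1 : ℕ) ≤ p⁻¹ := by
      by_contra! h
      obtain ⟨hk1, hk2⟩ := Finset.mem_Ico.1 hk
      have h1 : 0 ≤ rankDensity M (k + 1 : ℕ) := rankDensity_nonneg M _
      have h3 := (isGreatest_rankDensity M (t := (k + 1 : ℕ)) (by positivity)
        (by exact_mod_cast hk2)).1.2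
      set lam := rankDensity M (k + 1 : ℕ)
      have h4 := maxExcess_le_add M h1 hm
      have h5 := maxExcess_le_add M hm h1
      have h6 : (k : ℝ) + 1 ≤ rank M (denseSet M M.E lam) := by exact_mod_cast h3
      have h7 : (rank M D : ℝ) ≤ k := by exact_mod_cast hk1
      rw [← hD] at h5
      nlinarith
    calc _ ≤ p * p⁻¹ := by gcongr
      _ = 1 := mul_inv_cancel₀ hp.ne'

theorem eta_zero {n : ℕ} (w : Fin n → ℝ) : eta w 0 = 0 := by
  simp [eta, maxWeight]

theorem curveValue_rankDensity {α : Type*} (M : Matroid α) {n : ℕ} (w : Fin n → ℝ) :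
    curveValue w (rankDensity M) =
      ∑ k ∈ Finset.range (rank M M.E), eta w (rankDensity M (k + 1 : ℕ)) := by
  rw [curveValue]
  have hstep : ∀ k : ℕ, ∀ t ∈ Ioc (k : ℝ) ((k + 1 : ℕ) : ℝ),
      eta w (rankDensity M t) = eta w (rankDensity M (k + 1 : ℕ)) := by
    intro k t ht
    have h0 : 0 < t := (Nat.cast_nonneg k).trans_lt ht.1
    rw [rankDensity_eq_ceil M h0, (Nat.ceil_eq_iff (by omega)).2 ⟨by simpa using ht.1, ht.2⟩]
  have hint : ∀ k : ℕ, IntervalIntegrable (fun t => eta w (rankDensity M t)) MeasureTheory.volume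
      (k : ℝ) ((k + 1 : ℕ) : ℝ) := by
    intro k
    refine (intervalIntegrable_const (c := eta w (rankDensity M (k + 1 : ℕ)))).congr ?_
    rw [uIoc_of_le (by norm_num)]
    exact fun t ht => (hstep k t ht).symm
  have h1 : ∫ t in Ioi (0 : ℝ), eta w (rankDensity M t) =
      ∫ t in Ioc (0 : ℝ) (rank M M.E), eta w (rankDensity M t) := by
    refine MeasureTheory.setIntegral_eq_of_subset_of_forall_sdiff_eq_zero measurableSet_Ioi
      Ioc_subset_Ioi_self fun t ht => ?_
    rw [rankDensity_of_gt M, eta_zero]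
    by_contra! h
    exact ht.2 (mem_Ioc.2 ⟨ht.1, h⟩)
  rw [h1, ← intervalIntegral.integral_of_le (by positivity)]
  have h2 := intervalIntegral.sum_integral_adjacent_intervals (a := fun k : ℕ => (k : ℝ))
    (n := rank M M.E) fun k _ => hint k
  rw [Nat.cast_zero] at h2
  rw [← h2]
  refine Finset.sum_congr rfl fun k _ => ?_
  rw [intervalIntegral.integral_congr_ae (g := fun _ => eta w (rankDensity M (k + 1 : ℕ)))]
  · simp
  · rw [uIoc_of_le (by norm_num)]
    exact Filter.Eventually.of_forall (hstep k)

end Curve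

/-! ### Hitting probabilities of random subsets and random assignments -/

section Counting

open Finset in
theorem filter_disjoint_powersetCard {n : ℕ} (A : Finset (Fin n)) (m : ℕ) :
    {R ∈ powersetCard m (univ : Finset (Fin n)) | Disjoint R A} = powersetCard m Aᶜ := by
  ext R
  have := subset_compl_iff_disjoint_right (s := R) (t := A)
  simp only [mem_filter, mem_powersetCard]
  have := subset_univ R
  tauto

theorem descFactorial_mul_pow_le {b n : ℕ} (h : b ≤ n) (m : ℕ) :
    b.descFactorial m * n ^ m ≤ n.descFactorial m * b ^ m := by
  induction m with
  | zero => simp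
  | succ m ih =>
    -- Factorwise `(b - m)/(n - m) ≤ b/n`; the subtraction truncates when `b ≤ m`.
    have h1 : (b - m) * n ≤ (n - m) * b := by
      rcases le_total m b with hm | hm
      · zify [hm, hm.trans h]
        have : (b : ℤ) ≤ n := by exact_mod_cast h
        nlinarith
      · simp [Nat.sub_eq_zero_of_le hm]
    calc (b.descFactorial (m + 1)) * n ^ (m + 1)
        = ((b - m) * n) * (b.descFactorial m * n ^ m) := by rw [Nat.descFactorial_succ]; ring
      _ ≤ ((n - m) * b) * (n.descFactorial m * b ^ m) := Nat.mul_le_mul h1 ih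
      _ = _ := by rw [Nat.descFactorial_succ]; ring

theorem choose_mul_pow_le {b n : ℕ} (h : b ≤ n) (m : ℕ) :
    b.choose m * n ^ m ≤ n.choose m * b ^ m := by
  have := descFactorial_mul_pow_le h m
  rw [Nat.descFactorial_eq_factorial_mul_choose, Nat.descFactorial_eq_factorial_mul_choose,
    mul_assoc, mul_assoc] at this
  exact Nat.le_of_mul_le_mul_left this m.factorial_pos

/-- A random set of `m` indices meets `A` with probability at least `1 - (1 - |A| / n) ^ m`. -/
theorem le_expect_not_disjoint {n m : ℕ} (hm : m ≤ n) (hn : 0 < n) (A : Finset (Fin n)) :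
    1 - (1 - (A.card : ℝ) / n) ^ m ≤
      𝔼 R ∈ Finset.powersetCard m (Finset.univ : Finset (Fin n)),
        if Disjoint R A then (0 : ℝ) else 1 := by
  have hA : A.card ≤ n := by simpa using A.card_le_univ
  have hC : (0 : ℝ) < n.choose m := by exact_mod_cast Nat.choose_pos hm
  have hn' : (0 : ℝ) < n := by exact_mod_cast hn
  have h1 : ∀ R : Finset (Fin n), (if Disjoint R A then (0 : ℝ) else 1) =
      1 - if Disjoint R A then (1 : ℝ) else 0 := fun R => by split_ifs <;> simp
  simp only [h1]
  rw [Finset.expect_eq_sum_div_card, Finset.sum_sub_distrib, Finset.sum_boole,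
    filter_disjoint_powersetCard, Finset.card_powersetCard, Finset.sum_const,
    Finset.card_powersetCard, Finset.card_compl, Finset.card_univ, Fintype.card_fin,
    nsmul_one, sub_div, div_self hC.ne']
  refine sub_le_sub_left ?_ _
  have h2 : (1 - (A.card : ℝ) / n) = ((n - A.card : ℕ) : ℝ) / n := by
    rw [Nat.cast_sub hA]; field_simp
  rw [h2, div_pow, div_le_div_iff₀ hC (by positivity)]
  have := choose_mul_pow_le (Nat.sub_le n A.card) m
  calc _ ≤ ((n.choose m : ℝ) * ((n - A.card : ℕ) : ℝ) ^ m) := by exact_mod_cast this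
    _ = _ := mul_comm _ _

/-- A random set of `k` indices contains a given index with probability `k / n`. -/
theorem expect_mem_powersetCard {n k : ℕ} (hk : k ≤ n) (i : Fin n) :
    𝔼 S ∈ Finset.powersetCard k (Finset.univ : Finset (Fin n)),
      (if i ∈ S then (1 : ℝ) else 0) = k / n := by
  have hC : (0 : ℝ) < n.choose k := by exact_mod_cast Nat.choose_pos hk
  have hn : 0 < n := i.pos
  have hn' : (0 : ℝ) < n := by exact_mod_cast hn
  have h1 : ∀ S : Finset (Fin n), (if i ∈ S then (1 : ℝ) else 0) =
      1 - if Disjoint S {i} then (1 : ℝ) else 0 := fun S => by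
    by_cases h : i ∈ S <;> simp [h]
  simp only [h1]
  rw [Finset.expect_eq_sum_div_card, Finset.sum_sub_distrib, Finset.sum_boole,
    filter_disjoint_powersetCard, Finset.card_powersetCard, Finset.sum_const,
    Finset.card_powersetCard, Finset.card_compl, Finset.card_univ, Fintype.card_fin,
    nsmul_one, Finset.card_singleton]
  obtain ⟨n, rfl⟩ := Nat.exists_eq_succ_of_ne_zero hn.ne'
  have h2 := Nat.choose_mul_succ_eq n k
  have h3 : (n.choose k : ℝ) * (n + 1) = (n + 1).choose k * (n + 1 - k) := by
    have := congrArg (Nat.cast (R := ℝ)) h2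
    push_cast [Nat.cast_sub hk] at this
    exact this
  rw [div_eq_div_iff hC.ne' hn'.ne']
  simp only [Nat.succ_eq_add_one, Nat.add_sub_cancel]
  push_cast
  linarith

/-- Precomposition with a transposition makes the expectation independent of `e`, and the sum over
all `e` is the same for every bijection. -/
theorem expect_equiv_apply {β γ : Type*} [Fintype β] [DecidableEq β] [Fintype γ] [DecidableEq γ]
    (h : Fintype.card β = Fintype.card γ) (e : β) (g : γ → ℝ) :
    𝔼 σ : (β ≃ γ), g (σ e) = (∑ s, g s) / Fintype.card β := by
  have hne : Nonempty (β ≃ γ) := ⟨Fintype.equivOfCardEq h⟩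
  have hsymm : ∀ e', 𝔼 σ : (β ≃ γ), g (σ e') = 𝔼 σ : (β ≃ γ), g (σ e) := fun e' =>
    Fintype.expect_equiv ((Equiv.swap e e').equivCongr (Equiv.refl γ)) _ _ fun σ => by simp
  have h1 : ∑ e' : β, 𝔼 σ : (β ≃ γ), g (σ e') = ∑ s, g s := by
    rw [← Finset.expect_sum_comm]
    simp only [Equiv.sum_comp, Fintype.expect_const]
  have hpos : (0 : ℝ) < Fintype.card β := by exact_mod_cast Fintype.card_pos_iff.2 ⟨e⟩
  rw [← h1, Finset.sum_congr rfl fun e' _ => hsymm e', Finset.sum_const, Finset.card_univ,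
    nsmul_eq_mul, mul_div_cancel_left₀ _ hpos.ne']

/-- Under a random assignment, a given element gets an index in `A` with probability `|A| / n`. -/
theorem expect_assignment_mem {n : ℕ} {β : Type*} [Fintype β] [DecidableEq β]
    (hk : Fintype.card β ≤ n) (e : β) (A : Finset (Fin n)) :
    𝔼 S ∈ Finset.powersetCard (Fintype.card β) (Finset.univ : Finset (Fin n)),
      𝔼 σ : (β ≃ S), (if (σ e : Fin n) ∈ A then (1 : ℝ) else 0) = A.card / n := by
  have hpos : (0 : ℝ) < Fintype.card β := by exact_mod_cast Fintype.card_pos_iff.2 ⟨e⟩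
  rw [Finset.expect_congr rfl (g := fun S => (∑ i ∈ A, if i ∈ S then (1 : ℝ) else 0) /
    Fintype.card β), ← Finset.expect_div, Finset.expect_sum_comm,
    Finset.sum_congr rfl fun i _ => expect_mem_powersetCard hk i]
  · rw [Finset.sum_const, nsmul_eq_mul]
    field_simp
  · intro S hS
    rw [expect_equiv_apply (γ := S) (by simp [(Finset.mem_powersetCard.1 hS).2]) e
      (fun s => if (s : Fin n) ∈ A then (1 : ℝ) else 0)]
    congr 1
    rw [Finset.sum_coe_sort S (fun i => if i ∈ A then (1 : ℝ) else 0), Finset.sum_boole,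
      Finset.sum_boole, Finset.filter_mem_eq_inter, Finset.filter_mem_eq_inter, Finset.inter_comm]

theorem mul_min_le_one_sub_pow {p : ℝ} (hp1 : p ≤ 1) (hp0 : 0 ≤ p) (m : ℕ) :
    (1 - (Real.exp 1)⁻¹) * min 1 (p * m) ≤ 1 - (1 - p) ^ m := by
  have h1 : (1 - p) ^ m ≤ Real.exp (-(p * m)) := by
    calc (1 - p) ^ m ≤ Real.exp (-p) ^ m := by
          gcongr
          exact Real.one_sub_le_exp_neg p
      _ = _ := by rw [← Real.exp_nat_mul]; ring_nf
  have h0 : 0 ≤ p * m := by positivity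
  rw [← Real.exp_neg]
  rcases le_total 1 (p * m) with h | h
  · rw [min_eq_left h]
    have := Real.exp_le_exp.2 (neg_le_neg h)
    linarith
  · rw [min_eq_right h]
    -- On `[-1, 0]` the exponential lies below its chord: `exp (-x) ≤ 1 - (1 - 1/e) x`.
    have := convexOn_exp.2 (mem_univ (-1 : ℝ)) (mem_univ (0 : ℝ)) h0 (sub_nonneg.2 h) (by ring)
    simp only [smul_eq_mul, mul_zero, Real.exp_zero, mul_one, add_zero, mul_neg] at this
    linarith

end Counting

/-! ### Decomposition of the weights into threshold layers -/

section Layers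

/-- The coefficient of a value is its gap to the next smaller value, or to `0` for the smallest; the
sums then telescope. -/
theorem exists_layers (V : Finset ℝ) (hV : ∀ x ∈ V, 0 ≤ x) :
    ∃ c : ℝ → ℝ, (∀ v ∈ V, 0 ≤ c v) ∧ ∀ x ∈ V, x = ∑ v ∈ V, if v ≤ x then c v else 0 := by
  induction V using Finset.induction_on_max with
  | empty => exact ⟨0, by simp⟩
  | insert a V ha ih =>
    obtain ⟨c, hc, hsum⟩ := ih fun x hx => hV x (Finset.mem_insert_of_mem hx)
    have haV : a ∉ V := fun h => lt_irrefl _ (ha a h)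
    have hle : ∑ v ∈ V, c v ≤ a := by
      rcases V.eq_empty_or_nonempty with rfl | hne
      · simpa using hV a
      · have h := hsum _ (V.max'_mem hne)
        rw [Finset.sum_congr rfl fun v hv => if_pos (V.le_max' v hv)] at h
        rw [← h]
        exact (ha _ (V.max'_mem hne)).le
    have hcongr : ∀ x, (∑ v ∈ V, if v ≤ x then Function.update c a (a - ∑ v ∈ V, c v) v else 0) =
        ∑ v ∈ V, if v ≤ x then c v else 0 := fun x => Finset.sum_congr rfl fun v hv => by
      rw [Function.update_of_ne (ne_of_mem_of_not_mem hv haV)]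
    refine ⟨Function.update c a (a - ∑ v ∈ V, c v), fun v hv => ?_, fun x hx => ?_⟩
    · rcases Finset.mem_insert.1 hv with rfl | hv
      · simpa using hle
      · rw [Function.update_of_ne (ne_of_mem_of_not_mem hv haV)]
        exact hc v hv
    · rw [Finset.sum_insert haV, hcongr, Function.update_self]
      rcases Finset.mem_insert.1 hx with rfl | hx
      · rw [if_pos le_rfl, Finset.sum_congr rfl fun v hv => if_pos (ha v hv).le]
        ring
      · rw [if_neg (ha x hx).not_ge, zero_add]
        exact hsum x hx

/-- The indices of the weights that are at least `v`. -/
noncomputable def weightLevel {n : ℕ} (w : Fin n → ℝ) (v : ℝ) : Finset (Fin n) :=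
  Finset.univ.filter fun i => v ≤ w i

theorem mem_weightLevel {n : ℕ} {w : Fin n → ℝ} {v : ℝ} {i : Fin n} :
    i ∈ weightLevel w v ↔ v ≤ w i := by
  simp [weightLevel]

theorem layers_le_maxWeight {n : ℕ} {w : Fin n → ℝ} {V : Finset ℝ} {c : ℝ → ℝ}
    (hc : ∀ v ∈ V, 0 ≤ c v) (hw : ∀ i, w i = ∑ v ∈ V, if v ≤ w i then c v else 0)
    (R : Finset (Fin n)) :
    ∑ v ∈ V, c v * (if Disjoint R (weightLevel w v) then (0 : ℝ) else 1) ≤ maxWeight w R := by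
  rw [maxWeight]
  split_ifs with hR
  · obtain ⟨i, hi, hmax⟩ := Finset.exists_mem_eq_sup' hR w
    rw [hmax, hw i]
    refine Finset.sum_le_sum fun v hv => ?_
    by_cases h : Disjoint R (weightLevel w v)
    · rw [if_pos h, mul_zero]
      split_ifs
      exacts [hc v hv, le_rfl]
    · obtain ⟨j, hjR, hj⟩ := Finset.not_disjoint_iff.1 h
      have : v ≤ w i := (mem_weightLevel.1 hj).trans (hmax ▸ Finset.le_sup' w hjR)
      rw [if_neg h, if_pos this, mul_one]
  · simp [Finset.not_nonempty_iff_eq_empty.1 hR]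

/-- The factor `1 - 1/e` comes from the hitting probability of each layer, the factor `2` from
rounding `a` down. -/
theorem layers_le_eta {n : ℕ} {w : Fin n → ℝ} {V : Finset ℝ} {c : ℝ → ℝ}
    (hc : ∀ v ∈ V, 0 ≤ c v) (hw : ∀ i, w i = ∑ v ∈ V, if v ≤ w i then c v else 0)
    (hn : 0 < n) {a : ℝ} (ha1 : 1 ≤ a) (han : a ≤ n) :
    (1 - (Real.exp 1)⁻¹) * ∑ v ∈ V, c v *
      min 1 (((weightLevel w v).card : ℝ) / n * a) ≤ 2 * eta w a := by
  have hn' : (0 : ℝ) < n := by exact_mod_cast hn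
  have he : 0 ≤ 1 - (Real.exp 1)⁻¹ := by
    have : (Real.exp 1)⁻¹ ≤ 1 := inv_le_one_of_one_le₀ (Real.one_le_exp zero_le_one)
    linarith
  have hm : ⌊a⌋₊ ≤ n := Nat.floor_le_of_le han
  have h1 : ∑ v ∈ V, c v * (𝔼 R ∈ Finset.powersetCard ⌊a⌋₊ (Finset.univ : Finset (Fin n)),
      if Disjoint R (weightLevel w v) then (0 : ℝ) else 1) ≤ eta w a := by
    simp only [Finset.mul_expect]
    rw [← Finset.expect_sum_comm]
    exact Finset.expect_le_expect fun R _ => layers_le_maxWeight hc hw R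
  have hfl : a ≤ 2 * (⌊a⌋₊ : ℝ) := by
    have h2 := Nat.lt_floor_add_one a
    have h3 : (1 : ℝ) ≤ ⌊a⌋₊ := by exact_mod_cast (Nat.one_le_floor_iff a).2 ha1
    linarith
  refine le_trans ?_ (mul_le_mul_of_nonneg_left h1 zero_le_two)
  rw [Finset.mul_sum, Finset.mul_sum]
  refine Finset.sum_le_sum fun v hv => ?_
  set A := weightLevel w v
  have hp0 : 0 ≤ (A.card : ℝ) / n := by positivity
  have hp1 : (A.card : ℝ) / n ≤ 1 := by
    rw [div_le_one hn']
    exact_mod_cast A.card_le_univ.trans_eq (Fintype.card_fin n)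
  have h2 := (mul_min_le_one_sub_pow hp1 hp0 ⌊a⌋₊).trans (le_expect_not_disjoint hm hn A)
  have h3 : min 1 ((A.card : ℝ) / n * a) ≤ 2 * min 1 ((A.card : ℝ) / n * ⌊a⌋₊) := by
    rw [mul_min_of_nonneg _ _ zero_le_two]
    refine min_le_min (by norm_num) ?_
    calc _ ≤ (A.card : ℝ) / n * (2 * ⌊a⌋₊) := by gcongr
      _ = _ := by ring
  have h4 := mul_le_mul_of_nonneg_left h2 (hc v hv)
  have h5 := mul_le_mul_of_nonneg_left h3 (mul_nonneg he (hc v hv))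
  nlinarith

theorem card_filter_le_rank_add {α : Type*} (M : Matroid α) [M.Finite] [Fintype M.E]
    {I : Finset M.E} (hI : M.Indep (Subtype.val '' (I : Set M.E))) (D : Set α)
    (p : M.E → Prop) [DecidablePred p] [DecidablePred fun e : M.E => (e : α) ∈ D] :
    ((I.filter p).card : ℝ) ≤ rank M D + ∑ e ∈ Finset.univ.filter (fun e : M.E => (e : α) ∉ D), if p e then (1 : ℝ) else 0 := by
  have h1 : (I.filter p).card ≤
      (I.filter fun e : M.E => (e : α) ∈ D).card +
        ((Finset.univ.filter fun e : M.E => (e : α) ∉ D).filter p).card := by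
    classical
    rw [← Finset.card_filter_add_card_filter_not (s := I.filter p) (fun e => (e : α) ∈ D)]
    refine add_le_add (Finset.card_le_card fun e he => ?_) (Finset.card_le_card fun e he => ?_) <;>
    · simp only [Finset.mem_filter, Finset.mem_univ, true_and] at he ⊢
      tauto
  have h2 : (I.filter fun e : M.E => (e : α) ∈ D).card ≤ rank M D := by
    set J := I.filter fun e : M.E => (e : α) ∈ D with hJ
    have hJD : Subtype.val '' (J : Set M.E) ⊆ D := by
      rintro _ ⟨e, he, rfl⟩
      exact (Finset.mem_filter.1 he).2
    have hJI : M.Indep (Subtype.val '' (J : Set M.E)) :=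
      hI.subset (image_mono (by exact_mod_cast Finset.filter_subset _ _))
    have h := M.eRk_mono hJD
    rw [hJI.eRk_eq_encard, Subtype.val_injective.encard_image, encard_coe_eq_coe_finsetCard,
      ← coe_rank] at h
    exact_mod_cast h
  rw [Finset.sum_boole]
  exact_mod_cast h1.trans (Nat.add_le_add_right h2 _)

theorem optWeight_le_layers {α : Type*} (M : Matroid α) [M.Finite] [Fintype M.E]
    {v : M.E → ℝ} {V : Finset ℝ} {c : ℝ → ℝ} (hc : ∀ l ∈ V, 0 ≤ c l)
    (hv : ∀ e, v e = ∑ l ∈ V, if l ≤ v e then c l else 0) (D : ℝ → Set α)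
    [∀ l, DecidablePred fun e : M.E => (e : α) ∈ D l] :
    optWeight M v ≤ ∑ l ∈ V, c l *
      (rank M (D l) + ∑ e ∈ Finset.univ.filter (fun e : M.E => (e : α) ∉ D l), if l ≤ v e then (1 : ℝ) else 0) := by
  obtain ⟨I, hI, hopt⟩ := (isGreatest_optWeight M v).1
  rw [hopt, Finset.sum_congr rfl fun e _ => hv e, Finset.sum_comm]
  refine Finset.sum_le_sum fun l hl => ?_
  rw [← Finset.sum_filter, Finset.sum_const, nsmul_eq_mul, mul_comm]
  exact mul_le_mul_of_nonneg_left (card_filter_le_rank_add M hI (D l) _) (hc l hl)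

/-- The pointwise bound on `optWeight` no longer mentions the optimal set, so linearity of
expectation applies although that set depends on the assignment. Each layer may use its own `D l`.
-/
theorem expectedOpt_le_layers {α : Type*} {n : ℕ} (M : Matroid α) [M.Finite]
    (hM : M.E.ncard ≤ n) {w : Fin n → ℝ} {V : Finset ℝ} {c : ℝ → ℝ} (hc : ∀ l ∈ V, 0 ≤ c l)
    (hw : ∀ i, w i = ∑ l ∈ V, if l ≤ w i then c l else 0) (D : ℝ → Set α) :
    expectedOpt M w ≤ ∑ l ∈ V, c l * (rank M (D l) +
      ((weightLevel w l).card : ℝ) / n * (M.E \ D l).ncard) := by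
  classical
  let _ : Fintype M.E := M.ground_finite.fintype
  have hcard : M.E.ncard = Fintype.card M.E := by
    rw [← Nat.card_coe_set_eq, Nat.card_eq_fintype_card]
  have hdiff : ∀ l, (M.E \ D l).ncard = (Finset.univ.filter fun e : M.E => (e : α) ∉ D l).card := by
    intro l
    rw [← ncard_coe_finset, ← ncard_image_of_injective _ Subtype.val_injective]
    congr 1
    ext x
    simp [and_comm]
  have hne : (Finset.powersetCard M.E.ncard (Finset.univ : Finset (Fin n))).Nonempty :=
    Finset.powersetCard_nonempty.2 (by rwa [Finset.card_univ, Fintype.card_fin])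
  have h1 : expectedOpt M w ≤ 𝔼 S ∈ Finset.powersetCard M.E.ncard (Finset.univ : Finset (Fin n)),
      𝔼 σ : (M.E ≃ S), ∑ l ∈ V, c l * (rank M (D l) +
        ∑ e ∈ Finset.univ.filter (fun e : M.E => (e : α) ∉ D l), if (σ e : Fin n) ∈ weightLevel w l
          then (1 : ℝ) else 0) := by
    unfold expectedOpt
    refine Finset.expect_le_expect fun S _ => ?_
    refine Finset.expect_le_expect fun σ _ => ?_
    simp only [mem_weightLevel]
    exact optWeight_le_layers M (v := fun e => w (σ e)) hc (fun e => hw _) D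
  refine h1.trans (le_of_eq ?_)
  have h2 : ∀ S ∈ Finset.powersetCard M.E.ncard (Finset.univ : Finset (Fin n)),
      Nonempty (M.E ≃ S) := fun S hS =>
    ⟨Fintype.equivOfCardEq (by rw [Fintype.card_coe, (Finset.mem_powersetCard.1 hS).2, hcard])⟩
  simp only [Finset.expect_sum_comm, ← Finset.mul_expect, Finset.expect_add_distrib]
  refine Finset.sum_congr rfl fun l _ => ?_
  congr 2
  · rw [Finset.expect_congr rfl fun S hS => by
      have := h2 S hS
      exact Fintype.expect_const _, Finset.expect_const hne]
  · rw [hdiff, hcard, Finset.sum_congr rfl fun e _ => expect_assignment_mem (hcard ▸ hM) e _,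
      Finset.sum_const, nsmul_eq_mul, mul_comm]

end Layers

end RandomAssignment

/-! ### The main inequality -/

theorem mainTheorem5 {α : Type*} {n : ℕ} (w : Fin n → ℝ) (hw : ∀ i, 0 ≤ w i)
    (M : Matroid α) [M.Finite] (hM : M.E.ncard ≤ n) :
    RandomAssignment.expectedOpt M w ≤
      3 * Real.exp 1 / (Real.exp 1 - 1) *
        RandomAssignment.curveValue w (RandomAssignment.rankDensity M) := by
  classical
  obtain ⟨c, hc, hsum⟩ := RandomAssignment.exists_layers (Finset.univ.image w) (by simpa using hw)
  have hlay : ∀ i, w i = ∑ l ∈ Finset.univ.image w, if l ≤ w i then c l else 0 := fun i =>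
    hsum _ (Finset.mem_image_of_mem w (Finset.mem_univ i))
  set V := Finset.univ.image w with hV
  have hpos : ∀ l ∈ V, 0 < ((RandomAssignment.weightLevel w l).card : ℝ) / n := by
    intro l hl
    obtain ⟨i, -, rfl⟩ := Finset.mem_image.1 hl
    have hn : (0 : ℝ) < n := by exact_mod_cast i.pos
    have : 0 < (RandomAssignment.weightLevel w (w i)).card :=
      Finset.card_pos.2 ⟨i, RandomAssignment.mem_weightLevel.2 le_rfl⟩
    exact div_pos (by exact_mod_cast this) hn
  have hD : ∀ l, ∃ D : Set α, l ∈ V → RandomAssignment.rank M D +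
      ((RandomAssignment.weightLevel w l).card : ℝ) / n * (M.E \ D).ncard ≤
      ∑ k ∈ Finset.range (RandomAssignment.rank M M.E),
        min 1 (((RandomAssignment.weightLevel w l).card : ℝ) / n *
          RandomAssignment.rankDensity M (k + 1 : ℕ)) := by
    intro l
    by_cases hl : l ∈ V
    · obtain ⟨D, -, h⟩ := RandomAssignment.exists_rank_add_le_sum_min M (hpos l hl)
      exact ⟨D, fun _ => h⟩
    · exact ⟨∅, fun h => absurd h hl⟩
  choose D hD using hD
  have h1 := RandomAssignment.expectedOpt_le_layers M hM hc hlay D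
  have h2 := h1.trans (Finset.sum_le_sum fun l hl => mul_le_mul_of_nonneg_left (hD l hl) (hc l hl))
  simp only [Finset.mul_sum] at h2
  -- With the rank steps `k` outermost, each inner sum over layers is compared with a single
  -- `η(ρ(k+1))`.
  rw [Finset.sum_comm] at h2
  have he : 1 < Real.exp 1 := by simp
  have he' : 0 < 1 - (Real.exp 1)⁻¹ := sub_pos.2 (inv_lt_one_of_one_lt₀ he)
  rw [RandomAssignment.curveValue_rankDensity]
  set r := RandomAssignment.rank M M.E with hr
  set G := ∑ k ∈ Finset.range r, RandomAssignment.eta w (RandomAssignment.rankDensity M (k + 1 : ℕ))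
    with hG
  have h3 : (1 - (Real.exp 1)⁻¹) * RandomAssignment.expectedOpt M w ≤ 2 * G := by
    refine (mul_le_mul_of_nonneg_left h2 he'.le).trans ?_
    rw [hG, Finset.mul_sum, Finset.mul_sum]
    refine Finset.sum_le_sum fun k hk => ?_
    have h1le := RandomAssignment.one_le_rankDensity M (Finset.mem_range.1 hk)
    have hlen : RandomAssignment.rankDensity M (k + 1 : ℕ) ≤ n :=
      (RandomAssignment.rankDensity_le_ncard M _).trans (by exact_mod_cast hM)
    have hn : 0 < n := by exact_mod_cast zero_lt_one.trans_le (h1le.trans hlen)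
    exact RandomAssignment.layers_le_eta hc hlay hn h1le hlen
  -- Nonnegativity serves only to weaken the constant from `2` to `3`.
  have hG0 : 0 ≤ G := by
    refine Finset.sum_nonneg fun k _ => Finset.expect_nonneg fun R _ => ?_
    rw [RandomAssignment.maxWeight]
    split_ifs with h
    · obtain ⟨i, hi⟩ := h
      exact (hw i).trans (Finset.le_sup' w hi)
    · exact le_rfl
  have h4 : 3 * Real.exp 1 / (Real.exp 1 - 1) = 3 / (1 - (Real.exp 1)⁻¹) := by
    have : Real.exp 1 - 1 ≠ 0 := by linarith
    have : (1 - (Real.exp 1)⁻¹) ≠ 0 := he'.ne'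
    field_simp
  rw [h4, div_mul_eq_mul_div, le_div_iff₀ he']
  linarith
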